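/- Let $\mathbb{C}$ be a regular category, i.e. a category with finite limits in which every kernel pair has a coequalizer and regular epimorphisms are stable under pullback (equivalently, every morphism factors as a regular epimorphism followed by a monomorphism, and these factorizations are stable under pullback). A relation on an object $X$ is a subobject $\langle r_1,r_2\rangle\colon R\rightarrowtail X\times X$; for generalized elements $x,y\colon A\to X$ we write $(x,y)\in R$ when $\langle x,y\rangle\colon A\to X\times X$ factors through $R$. The relation $R$ is reflexive if it contains the diagonal of $X$, and it is an equivalence relation if it is reflexive, symmetric and transitive. Then the following conditions are equivalent: (i) $\mathbb{C}$ is a Mal'tsev category, i.e. every reflexive relation in $\mathbb{C}$ is an equivalence relation; (ii) the Shifting Lemma holds in $\mathbb{C}$ for reflexive relations, i.e. for every object $X$ and all reflexive relations $R,S,T$ on $X$ with $R\wedge S\leqslant T$, and for all generalized elements $x,y,u,v\colon A\to X$ (with $A$ any object of $\mathbb{C}$), if $(x,y)\in R\wedge T$, $(x,u)\in S$, $(y,v)\in S$ and $(u,v)\in R$, then $(u,v)\in T$. -/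

import Mathlib

universe v u

namespace RegularRelations

open CategoryTheory CategoryTheory.Limits

variable {C : Type u} [Category.{v} C] [HasFiniteLimits C]

/-- An internal relation from `X` to `Y`: a subobject of `X ⨯ Y`. -/
abbrev Relation (X Y : C) := Subobject (X ⨯ Y)

/-- The first leg `r₁ : R ⟶ X` of a relation `⟨r₁, r₂⟩ : R ↣ X ⨯ Y`. -/
noncomputable abbrev leg₁ {X Y : C} (R : Relation X Y) : (R : C) ⟶ X := R.arrow ≫ prod.fst

/-- The second leg `r₂ : R ⟶ Y` of a relation `⟨r₁, r₂⟩ : R ↣ X ⨯ Y`. -/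
noncomputable abbrev leg₂ {X Y : C} (R : Relation X Y) : (R : C) ⟶ Y := R.arrow ≫ prod.snd

/-- `(x, y) ∈ R` for generalised elements `x : A ⟶ X` and `y : A ⟶ Y`: the morphism
`⟨x, y⟩ : A ⟶ X ⨯ Y` factors through `R`. -/
def Holds {X Y : C} (R : Relation X Y) {A : C} (x : A ⟶ X) (y : A ⟶ Y) : Prop :=
  R.Factors (prod.lift x y)

/-- A relation on `X` is reflexive when its legs admit a common section `X ⟶ R`,
that is, when the diagonal of `X` is contained in `R`. -/
def IsReflexive {X : C} (R : Relation X X) : Prop :=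
  Nonempty (ReflexiveRelation (leg₁ R) (leg₂ R))

/-- A relation on `X` is an (internal) equivalence relation when it is reflexive, symmetric and
transitive. -/
def IsEquivalence {X : C} (R : Relation X X) : Prop :=
  IsEquivalenceRelation (leg₁ R) (leg₂ R)

/-- A finitely complete category is a Mal'tsev category if every reflexive relation in it is an
equivalence relation. -/
def IsMaltsevCategory (C : Type u) [Category.{v} C] [HasFiniteLimits C] : Prop :=
  ∀ (X : C) (R : Relation X X), IsReflexive R → IsEquivalence R

/-- The shifting property for three relations `R`, `S`, `T` on `X`: if `R ∧ S ≤ T`, then for all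
generalised elements `x, y, u, v` of `X` with `(x, y) ∈ R ∧ T`, `(x, u) ∈ S`, `(y, v) ∈ S` and
`(u, v) ∈ R`, one has `(u, v) ∈ T`. -/
def ShiftingProperty {X : C} (R S T : Relation X X) : Prop :=
  R ⊓ S ≤ T → ∀ (A : C) (x y u v : A ⟶ X),
    Holds (R ⊓ T) x y → Holds S x u → Holds S y v → Holds R u v → Holds T u v

/-- The Shifting Lemma holds in `C` for all reflexive relations `R`, `S`, `T` on the same
object. -/
def ShiftingLemmaForReflexive (C : Type u) [Category.{v} C] [HasFiniteLimits C] : Prop :=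
  ∀ (X : C) (R S T : Relation X X), IsReflexive R → IsReflexive S → IsReflexive T →
    ShiftingProperty R S T

end RegularRelations

/-! Membership of generalised elements in a relation can be tested after precomposing with a strong
epimorphism, so composites of relations may be manipulated through local witnesses.

For `(i) → (ii)`: in a Mal'tsev category the composite of two reflexive relations, being reflexive,
is symmetric, so reflexive relations commute. Commuting `S` past `R ∧ T` in `u S x (R ∧ T) y` gives
locally some `w` with `u (R ∧ T) w S y`. Then `w (R ∧ S) v`, hence `w T v` and `u T v`.

For `(ii) → (i)`: the Shifting Lemma for `E°, E, E` shows that a reflexive relation `E` is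
symmetric. Transitivity of `E` follows from symmetry of the reflexive relation
`{(f, g) | (f₁, g₂) ∈ E}` on the object `E` itself: if `f = (a, b)` and `g = (b, c)`, it contains
`(g, f)` because `(b, b) ∈ E`, hence also `(f, g)`, that is, `(a, c) ∈ E`.
-/

namespace RegularRelations

open CategoryTheory CategoryTheory.Limits

theorem factors_of_strongEpi {C : Type u} [Category.{v} C] {X A B : C} {P : Subobject X}
    (q : B ⟶ A) [StrongEpi q] {f : A ⟶ X} (h : P.Factors (q ≫ f)) : P.Factors f := by
  have sq : CommSq (P.factorThru _ h) q P.arrow f := ⟨P.factorThru_arrow _ h⟩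
  exact (Subobject.factors_iff _ _).2 ⟨sq.lift, sq.fac_right⟩

section Elements

variable {C : Type u} [Category.{v} C] [HasFiniteLimits C] {X Y : C} {R S : Relation X Y}

theorem Holds.precomp {A B : C} {x : A ⟶ X} {y : A ⟶ Y} (h : Holds R x y) (q : B ⟶ A) :
    Holds R (q ≫ x) (q ≫ y) := by
  simpa only [Holds, ← prod.comp_lift] using Subobject.factors_of_factors_right q h

theorem Holds.of_strongEpi {A B : C} {x : A ⟶ X} {y : A ⟶ Y} (q : B ⟶ A) [StrongEpi q]
    (h : Holds R (q ≫ x) (q ≫ y)) : Holds R x y := by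
  rw [Holds, ← prod.comp_lift] at h
  exact factors_of_strongEpi q h

theorem lift_legs (R : Relation X Y) : prod.lift (leg₁ R) (leg₂ R) = R.arrow := by
  rw [← prod.comp_lift, prod.lift_fst_snd, Category.comp_id]

theorem holds_comp_legs (R : Relation X Y) {A : C} (f : A ⟶ (R : C)) :
    Holds R (f ≫ leg₁ R) (f ≫ leg₂ R) := by
  rw [Holds, ← prod.comp_lift, lift_legs]
  exact Subobject.factors_comp_arrow f

theorem holds_legs (R : Relation X Y) : Holds R (leg₁ R) (leg₂ R) := by
  simpa only [Category.id_comp] using holds_comp_legs R (𝟙 _)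

theorem holds_iff_exists_comp_legs {A : C} {x : A ⟶ X} {y : A ⟶ Y} :
    Holds R x y ↔ ∃ f : A ⟶ (R : C), f ≫ leg₁ R = x ∧ f ≫ leg₂ R = y := by
  constructor
  · intro h
    rw [Holds] at h
    exact ⟨R.factorThru _ h, by rw [Subobject.factorThru_arrow_assoc, prod.lift_fst],
      by rw [Subobject.factorThru_arrow_assoc, prod.lift_snd]⟩
  · rintro ⟨f, rfl, rfl⟩
    exact holds_comp_legs R f

theorem holds_inf {A : C} {x : A ⟶ X} {y : A ⟶ Y} :
    Holds (R ⊓ S) x y ↔ Holds R x y ∧ Holds S x y :=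
  Subobject.inf_factors _

theorem Holds.mono (hRS : R ≤ S) {A : C} {x : A ⟶ X} {y : A ⟶ Y} (h : Holds R x y) :
    Holds S x y :=
  Subobject.factors_of_le _ hRS h

theorem le_of_holds (h : ∀ ⦃A : C⦄ (x : A ⟶ X) (y : A ⟶ Y), Holds R x y → Holds S x y) :
    R ≤ S := by
  refine Subobject.le_of_factors ?_
  rw [← lift_legs]
  exact h _ _ (holds_legs R)

theorem jointlyMono₂_legs (R : Relation X Y) : JointlyMono₂ (leg₁ R) (leg₂ R) where
  right_cancellation A f g h₁ h₂ := by
    rw [← cancel_mono R.arrow, ← lift_legs, prod.comp_lift, prod.comp_lift, h₁, h₂]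

/-- The opposite `R°` of a relation `R`, obtained by pulling `R` back along the exchange of
factors. -/
noncomputable def opposite (R : Relation X Y) : Relation Y X :=
  (Subobject.pullback (prod.lift prod.snd prod.fst)).obj R

theorem holds_opposite {A : C} {x : A ⟶ X} {y : A ⟶ Y} :
    Holds (opposite R) y x ↔ Holds R x y := by
  simp only [Holds, opposite, Limits.pullback_factors_iff, prod.comp_lift, prod.lift_fst,
    prod.lift_snd]

/-- The inverse image `{(x, y) | (f x, g y) ∈ R}` of a relation `R` along `f` and `g`. -/
noncomputable def inverseImage {X' Y' : C} (f : X' ⟶ X) (g : Y' ⟶ Y) (R : Relation X Y) :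
    Relation X' Y' :=
  (Subobject.pullback (prod.map f g)).obj R

theorem holds_inverseImage {X' Y' A : C} {f : X' ⟶ X} {g : Y' ⟶ Y} {x : A ⟶ X'} {y : A ⟶ Y'} :
    Holds (inverseImage f g R) x y ↔ Holds R (x ≫ f) (y ≫ g) := by
  simp only [Holds, inverseImage, Limits.pullback_factors_iff, prod.lift_map]

end Elements

section Endorelations

variable {C : Type u} [Category.{v} C] [HasFiniteLimits C] {X : C} {R : Relation X X}

theorem isReflexive_iff_holds : IsReflexive R ↔ ∀ ⦃A : C⦄ (x : A ⟶ X), Holds R x x := by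
  constructor
  · rintro ⟨h⟩ A x
    exact holds_iff_exists_comp_legs.2 ⟨x ≫ h.r,
      by rw [Category.assoc, h.reflexivity₁, Category.comp_id],
      by rw [Category.assoc, h.reflexivity₂, Category.comp_id]⟩
  · intro h
    obtain ⟨r, hr₁, hr₂⟩ := holds_iff_exists_comp_legs.1 (h (𝟙 X))
    exact ⟨{ jointlyMono₂_legs R with r := r, reflexivity₁ := hr₁, reflexivity₂ := hr₂ }⟩

theorem IsEquivalence.equivalence_holds (hR : IsEquivalence R) (A : C) :
    Equivalence (Holds R (A := A)) := by
  obtain ⟨e⟩ := hR.nonempty_equivalenceRelation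
  refine ⟨isReflexive_iff_holds.1 ⟨e.toReflexiveRelation⟩ (A := A), fun {x y} hxy => ?_,
    fun {x y z} hxy hyz => ?_⟩
  · obtain ⟨f, rfl, rfl⟩ := holds_iff_exists_comp_legs.1 hxy
    exact holds_iff_exists_comp_legs.2 ⟨f ≫ e.s, by rw [Category.assoc, e.symmetry₁],
      by rw [Category.assoc, e.symmetry₂]⟩
  · obtain ⟨f, rfl, rfl⟩ := holds_iff_exists_comp_legs.1 hxy
    obtain ⟨g, hgf, rfl⟩ := holds_iff_exists_comp_legs.1 hyz
    obtain ⟨l, rfl, rfl⟩ := PullbackCone.IsLimit.lift' e.isLimit f g hgf.symm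
    exact holds_iff_exists_comp_legs.2 ⟨l ≫ e.t,
      by rw [Category.assoc, e.transitivity₁, Category.assoc],
      by rw [Category.assoc, e.transitivity₂, Category.assoc]⟩

theorem isEquivalence_of_equivalence_holds (hR : ∀ A : C, Equivalence (Holds R (A := A))) :
    IsEquivalence R := by
  obtain ⟨r, hr₁, hr₂⟩ := holds_iff_exists_comp_legs.1 ((hR X).refl (𝟙 X))
  obtain ⟨s, hs₁, hs₂⟩ := holds_iff_exists_comp_legs.1 ((hR _).symm (holds_legs R))
  have hcomp : Holds R (pullback.fst (leg₂ R) (leg₁ R) ≫ leg₁ R)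
      (pullback.snd (leg₂ R) (leg₁ R) ≫ leg₂ R) := by
    refine (hR _).trans (holds_comp_legs R _) ?_
    rw [pullback.condition]
    exact holds_comp_legs R _
  obtain ⟨t, ht₁, ht₂⟩ := holds_iff_exists_comp_legs.1 hcomp
  exact ⟨⟨{ jointlyMono₂_legs R with
    r := r
    reflexivity₁ := hr₁
    reflexivity₂ := hr₂
    s := s
    symmetry₁ := hs₁
    symmetry₂ := hs₂
    c := pullback.cone (leg₂ R) (leg₁ R)
    isLimit := pullback.isLimit _ _
    t := t
    transitivity₁ := ht₁
    transitivity₂ := ht₂ }⟩⟩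

theorem IsReflexive.inf {S : Relation X X} (hR : IsReflexive R) (hS : IsReflexive S) :
    IsReflexive (R ⊓ S) :=
  isReflexive_iff_holds.2 fun _ x =>
    holds_inf.2 ⟨isReflexive_iff_holds.1 hR x, isReflexive_iff_holds.1 hS x⟩

theorem IsReflexive.opposite (hR : IsReflexive R) : IsReflexive (opposite R) :=
  isReflexive_iff_holds.2 fun _ x => holds_opposite.2 (isReflexive_iff_holds.1 hR x)

theorem isReflexive_inverseImage_legs (R : Relation X X) :
    IsReflexive (inverseImage (leg₁ R) (leg₂ R) R) :=
  isReflexive_iff_holds.2 fun _ f => holds_inverseImage.2 (holds_comp_legs R f)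

theorem isMaltsevCategory_of_symm
    (hsymm : ∀ (X : C) (R : Relation X X), IsReflexive R →
      ∀ (A : C) (x y : A ⟶ X), Holds R x y → Holds R y x) :
    IsMaltsevCategory C := by
  intro X E hE
  have hrefl := isReflexive_iff_holds.1 hE
  refine isEquivalence_of_equivalence_holds fun A =>
    ⟨hrefl (A := A), hsymm X E hE A _ _, fun {a b c} hab hbc => ?_⟩
  obtain ⟨f, hfa, hfb⟩ := holds_iff_exists_comp_legs.1 hab
  obtain ⟨g, hgb, hgc⟩ := holds_iff_exists_comp_legs.1 hbc
  have hgf : Holds (inverseImage (leg₁ E) (leg₂ E) E) g f := by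
    rw [holds_inverseImage, hgb, hfb]
    exact hrefl b
  have hfg := hsymm _ _ (isReflexive_inverseImage_legs E) A g f hgf
  rwa [holds_inverseImage, hfa, hgc] at hfg

theorem ShiftingProperty.symm (h : ShiftingProperty (opposite R) R R) (hR : IsReflexive R) {A : C}
    {x y : A ⟶ X} (hxy : Holds R x y) : Holds R y x := by
  have hx : Holds R x x := isReflexive_iff_holds.1 hR x
  have hx' : Holds (opposite R ⊓ R) x x := holds_inf.2 ⟨holds_opposite.2 hx, hx⟩
  exact h inf_le_right A x x y x hx' hxy hx (holds_opposite.2 hxy)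

theorem ShiftingLemmaForReflexive.isMaltsevCategory (h : ShiftingLemmaForReflexive C) :
    IsMaltsevCategory C :=
  isMaltsevCategory_of_symm fun X E hE _ _ _ =>
    (h X (opposite E) E E hE.opposite hE hE).symm hE

end Endorelations

section Composition

variable {C : Type u} [Category.{v} C] [Regular C]

theorem imageSubobject_factors_iff {P A Y : C} {f : P ⟶ Y} {g : A ⟶ Y} :
    (imageSubobject f).Factors g ↔
      ∃ (B : C) (q : B ⟶ A) (p : B ⟶ P), StrongEpi q ∧ q ≫ g = p ≫ f := by
  constructor
  · intro h
    obtain ⟨k, rfl⟩ : ∃ k : A ⟶ image f, k ≫ image.ι f = g := (Subobject.mk_factors_iff _ _).1 h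
    refine ⟨_, pullback.fst k (factorThruImage f), pullback.snd k (factorThruImage f),
      inferInstance, ?_⟩
    rw [pullback.condition_assoc, image.fac]
  · rintro ⟨B, q, p, hq, hqp⟩
    exact factors_of_strongEpi q (hqp ▸ imageSubobject_factors_comp_self f p)

/-- The composite `{(x, z) | ∃ y, (x, y) ∈ R ∧ (y, z) ∈ S}` of two relations, in diagrammatic
order: the image in `X ⨯ Z` of the pullback of `R` and `S` over `Y`. -/
noncomputable def composite {X Y Z : C} (R : Relation X Y) (S : Relation Y Z) : Relation X Z :=
  imageSubobject (prod.lift (pullback.fst (leg₂ R) (leg₁ S) ≫ leg₁ R)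
    (pullback.snd (leg₂ R) (leg₁ S) ≫ leg₂ S))

theorem holds_composite_iff {X Y Z A : C} {R : Relation X Y} {S : Relation Y Z} {x : A ⟶ X}
    {z : A ⟶ Z} :
    Holds (composite R S) x z ↔
      ∃ (B : C) (q : B ⟶ A) (y : B ⟶ Y),
        StrongEpi q ∧ Holds R (q ≫ x) y ∧ Holds S y (q ≫ z) := by
  rw [Holds, composite, imageSubobject_factors_iff]
  constructor
  · rintro ⟨B, q, p, hq, hqp⟩
    have hx := congrArg (· ≫ prod.fst) hqp
    have hz := congrArg (· ≫ prod.snd) hqp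
    simp only [Category.assoc, prod.lift_fst, prod.lift_snd] at hx hz
    refine ⟨B, q, p ≫ pullback.fst (leg₂ R) (leg₁ S) ≫ leg₂ R, hq, ?_, ?_⟩
    · rw [hx]
      simpa only [Category.assoc] using holds_comp_legs R (p ≫ pullback.fst (leg₂ R) (leg₁ S))
    · rw [hz, pullback.condition]
      simpa only [Category.assoc] using holds_comp_legs S (p ≫ pullback.snd (leg₂ R) (leg₁ S))
  · rintro ⟨B, q, y, hq, hR, hS⟩
    obtain ⟨f, hfx, hfy⟩ := holds_iff_exists_comp_legs.1 hR
    obtain ⟨g, hgy, hgz⟩ := holds_iff_exists_comp_legs.1 hS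
    refine ⟨B, q, pullback.lift f g (hfy.trans hgy.symm), hq, ?_⟩
    rw [prod.comp_lift, prod.comp_lift, pullback.lift_fst_assoc, pullback.lift_snd_assoc, hfx, hgz]

theorem Holds.composite {X Y Z A : C} {R : Relation X Y} {S : Relation Y Z} {x : A ⟶ X}
    {y : A ⟶ Y} {z : A ⟶ Z} (hxy : Holds R x y) (hyz : Holds S y z) :
    Holds (composite R S) x z :=
  holds_composite_iff.2 ⟨A, 𝟙 A, y, inferInstance, by rwa [Category.id_comp],
    by rwa [Category.id_comp]⟩

variable {X : C} {R S T : Relation X X}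

theorem IsReflexive.composite (hR : IsReflexive R) (hS : IsReflexive S) :
    IsReflexive (composite R S) :=
  isReflexive_iff_holds.2 fun _ x =>
    (isReflexive_iff_holds.1 hR x).composite (isReflexive_iff_holds.1 hS x)

theorem composite_le_composite_of_isEquivalence (hR : IsEquivalence R) (hS : IsEquivalence S)
    (hRS : IsEquivalence (composite R S)) : composite R S ≤ composite S R := by
  refine le_of_holds fun A x z hxz => ?_
  have hzx := (hRS.equivalence_holds A).symm hxz
  obtain ⟨B, q, y, hq, hzy, hyx⟩ := holds_composite_iff.1 hzx
  exact holds_composite_iff.2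
    ⟨B, q, y, hq, (hS.equivalence_holds B).symm hyx, (hR.equivalence_holds B).symm hzy⟩

theorem IsMaltsevCategory.composite_comm (hC : IsMaltsevCategory C) (hR : IsReflexive R)
    (hS : IsReflexive S) : composite R S = composite S R :=
  le_antisymm
    (composite_le_composite_of_isEquivalence (hC X R hR) (hC X S hS) (hC X _ (hR.composite hS)))
    (composite_le_composite_of_isEquivalence (hC X S hS) (hC X R hR) (hC X _ (hS.composite hR)))

theorem shiftingProperty_of_composite_le (hR : IsEquivalence R) (hS : IsEquivalence S)
    (hT : IsEquivalence T) (hcomm : composite S (R ⊓ T) ≤ composite (R ⊓ T) S) :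
    ShiftingProperty R S T := by
  intro hRST A x y u v hxy hxu hyv huv
  have huy : Holds (composite (R ⊓ T) S) u y :=
    (((hS.equivalence_holds A).symm hxu).composite hxy).mono hcomm
  obtain ⟨B, q, w, hq, huw, hwy⟩ := holds_composite_iff.1 huy
  obtain ⟨huwR, huwT⟩ := holds_inf.1 huw
  have hR := hR.equivalence_holds B
  have hS := hS.equivalence_holds B
  have hT := hT.equivalence_holds B
  have hwvR : Holds R w (q ≫ v) := hR.trans (hR.symm huwR) (huv.precomp q)
  have hwvS : Holds S w (q ≫ v) := hS.trans hwy (hyv.precomp q)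
  have hwvT : Holds T w (q ≫ v) := (holds_inf.2 ⟨hwvR, hwvS⟩).mono hRST
  exact Holds.of_strongEpi q (hT.trans huwT hwvT)

theorem IsMaltsevCategory.shiftingLemmaForReflexive (hC : IsMaltsevCategory C) :
    ShiftingLemmaForReflexive C := fun X R S T hR hS hT =>
  shiftingProperty_of_composite_le (hC X R hR) (hC X S hS) (hC X T hT)
    (hC.composite_comm hS (hR.inf hT)).le

end Composition

end RegularRelations

theorem theorem2p2 (C : Type u) [CategoryTheory.Category.{v} C] [CategoryTheory.Regular C] :
    RegularRelations.IsMaltsevCategory C ↔ RegularRelations.ShiftingLemmaForReflexive C :=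
  ⟨RegularRelations.IsMaltsevCategory.shiftingLemmaForReflexive,
    RegularRelations.ShiftingLemmaForReflexive.isMaltsevCategory⟩
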